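/- Let $N\ge 1$ and let $T^a$, $a=1,\dots,N^2-1$, be generators of $su(N)$ in the defining representation: Hermitian traceless $N\times N$ matrices with $\mathrm{Tr}(T^aT^b)=\tfrac12\delta^{ab}$. Fix a real number $c\neq 0$ and let $G^0=c\cdot\mathbf 1$, $G^a=T^a$ ($a=1,\dots,N^2-1$) be the corresponding complete basis of $gl(N,\mathbb C)$; the matrices $iG^a$ form a real basis of $u(N)$, the Lie algebra of skew-Hermitian matrices. For a family of Hermitian matrices $(H^a)$ put $$f^{abc}=-2i\,\mathrm{Tr}\big([H^a,H^b]H^c\big),\qquad d^{abc}=2\,\mathrm{Tr}\big(\{H^a,H^b\}H^c\big).$$ For $H^a=T^a$ these are the usual symbols of $su(N)$: $[T^a,T^b]=i f^{abc}T^c$ and $\{T^a,T^b\}=\tfrac1N\delta^{ab}\mathbf 1+d^{abc}T^c$. We say that an array $\Phi^{a_1\dots a_n}$ is expressed through $\delta^{ab},f^{abc},d^{abc}$ of the family $(H^a)$ over a field $\mathbb K\in\{\mathbb R,\mathbb C\}$ if it is a finite $\mathbb K$-linear combination of products of these symbols (the empty product $1$ included) in which each index is either one of the free indices $a_1,\dots,a_n$,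 each of these occurring exactly once, or a summation index occurring exactly twice. Let $n\ge 0$. 1. Let $\Phi$ be a $\mathbb C$-multilinear $n$-form $\Phi:gl(N,\mathbb C)^n\to\mathbb C$ which is Ad-invariant, i.e. $\Phi(gX_1g^{-1},\dots,gX_ng^{-1})=\Phi(X_1,\dots,X_n)$ for all $g\in GL(N,\mathbb C)$, and let $\Phi^{a_1\dots a_n}=\Phi(G^{a_1},\dots,G^{a_n})$, $a_i\in\{0,\dots,N^2-1\}$. Then (a) $\Phi^{a_1\dots a_n}$ is expressed over $\mathbb C$ through $\delta^{ab},f^{abc},d^{abc}$ of the complete basis $(G^a)_{0\le a\le N^2-1}$; (b) if any set of indices of $\Phi^{a_1\dots a_n}$ (possibly none or all of them) is set equal to $0$ and the others are restricted to $1,\dots,N^2-1$, the resulting array in the remaining indices is expressed over $\mathbb C$ through the $su(N)$ symbols $\delta^{ab},f^{abc},d^{abc}$ of $(T^a)_{1\le a\le N^2-1}$. 2. Let $\Phi$ be an $\mathbb R$-multilinear $n$-form $\Phi:u(N)^n\to\mathbb R$ which is Ad-invariant, i.e. $\Phi(UX_1U^{-1},\dots,UX_nU^{-1})=\Phi(X_1,\dots,X_n)$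 for all $U\in U(N)$, and let $\Phi^{a_1\dots a_n}=\Phi(iG^{a_1},\dots,iG^{a_n})$. Then (a) and (b) hold with $\mathbb R$ in place of $\mathbb C$. -/

import Mathlib

/-- Generators `T^a`, `a = 1, …, N² - 1`, of `su(N)` in the defining representation, in the physics
normalization: Hermitian traceless matrices with `Tr (T^a T^b) = δ^{ab} / 2`. Orthogonality and
their number make them a real basis of the traceless Hermitian matrices. -/
structure SuGenerators (N : ℕ) where
  gen : Fin (N ^ 2 - 1) → Matrix (Fin N) (Fin N) ℂ
  hermitian : ∀ a, IsSelfAdjoint (gen a)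
  traceless : ∀ a, (gen a).trace = 0
  normalized : ∀ a b, (gen a * gen b).trace = if a = b then 1 / 2 else 0

/-- The extended basis `G^a`, `a = 0, 1, …, N² - 1`, of `gl(N, ℂ)`: `G^0 = c · 1` (index `none`)
and `G^a = T^a` otherwise (index `some a`). -/
def SuGenerators.extended {N : ℕ} (T : SuGenerators N) (c : ℝ) :
    Option (Fin (N ^ 2 - 1)) → Matrix (Fin N) (Fin N) ℂ
  | none => (c : ℂ) • (1 : Matrix (Fin N) (Fin N) ℂ)
  | some a => T.gen a

theorem SuGenerators.extended_isSelfAdjoint {N : ℕ} (T : SuGenerators N) (c : ℝ)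
    (a : Option (Fin (N ^ 2 - 1))) : IsSelfAdjoint (T.extended c a) := by
  cases a with
  | none =>
    simp [SuGenerators.extended, isSelfAdjoint_iff, star_smul]
  | some a => exact T.hermitian a

/-- The Lie algebra `u(N)` of the unitary group: skew-Hermitian matrices. -/
abbrev UnitaryLie (N : ℕ) : Type := skewAdjoint (Matrix (Fin N) (Fin N) ℂ)

/-- The basis `i G^a` of the real vector space `u(N)`. -/
def SuGenerators.extendedU {N : ℕ} (T : SuGenerators N) (c : ℝ) (a : Option (Fin (N ^ 2 - 1))) :
    UnitaryLie N :=
  ⟨Complex.I • T.extended c a,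
    IsSelfAdjoint.smul_mem_skewAdjoint (by simp [skewAdjoint.mem_iff])
      (T.extended_isSelfAdjoint c a)⟩

/-- `f^{abc} = -2 i Tr ([G^a, G^b] G^c)`; the trace expression is real for Hermitian `G`. -/
noncomputable def fSymbol {N : ℕ} {A : Type} (G : A → Matrix (Fin N) (Fin N) ℂ) (a b c : A) : ℝ :=
  (-2 * Complex.I * ((G a * G b - G b * G a) * G c).trace).re

/-- `d^{abc} = 2 Tr ({G^a, G^b} G^c)`; the trace expression is real for Hermitian `G`. -/
noncomputable def dSymbol {N : ℕ} {A : Type} (G : A → Matrix (Fin N) (Fin N) ℂ) (a b c : A) : ℝ :=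
  (2 * ((G a * G b + G b * G a) * G c).trace).re

/-- `ExpressibleByDeltaFD 𝕜 G n Φ`: the array `Φ^{a_1 … a_n}` is a `𝕜`-linear combination of
products of the symbols `δ^{ab}`, `f^{abc}`, `d^{abc}` of the family `G`, in which every index is
either one of the free indices `a_1, …, a_n` (used once) or is summed over (used twice). These
arrays form the smallest family which contains the scalar `1` and the three symbols and is closed
under linear combinations, tensor products, permutations of indices and contractions. -/
inductive ExpressibleByDeltaFD (𝕜 : Type) [RCLike 𝕜] {N : ℕ} {A : Type} [Fintype A] [DecidableEq A]
    (G : A → Matrix (Fin N) (Fin N) ℂ) : (n : ℕ) → ((Fin n → A) → 𝕜) → Prop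
  | one : ExpressibleByDeltaFD 𝕜 G 0 (fun _ => 1)
  | delta : ExpressibleByDeltaFD 𝕜 G 2 (fun a => if a 0 = a 1 then 1 else 0)
  | f : ExpressibleByDeltaFD 𝕜 G 3 (fun a => (fSymbol G (a 0) (a 1) (a 2) : 𝕜))
  | d : ExpressibleByDeltaFD 𝕜 G 3 (fun a => (dSymbol G (a 0) (a 1) (a 2) : 𝕜))
  | add {n : ℕ} {Φ Ψ : (Fin n → A) → 𝕜} (hΦ : ExpressibleByDeltaFD 𝕜 G n Φ)
      (hΨ : ExpressibleByDeltaFD 𝕜 G n Ψ) : ExpressibleByDeltaFD 𝕜 G n (fun a => Φ a + Ψ a)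
  | smul {n : ℕ} {Φ : (Fin n → A) → 𝕜} (r : 𝕜) (hΦ : ExpressibleByDeltaFD 𝕜 G n Φ) :
      ExpressibleByDeltaFD 𝕜 G n (fun a => r * Φ a)
  | prod {m n : ℕ} {Φ : (Fin m → A) → 𝕜} {Ψ : (Fin n → A) → 𝕜}
      (hΦ : ExpressibleByDeltaFD 𝕜 G m Φ) (hΨ : ExpressibleByDeltaFD 𝕜 G n Ψ) :
      ExpressibleByDeltaFD 𝕜 G (m + n)
        (fun a => Φ (fun i => a (Fin.castAdd n i)) * Ψ (fun j => a (Fin.natAdd m j)))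
  | perm {n : ℕ} {Φ : (Fin n → A) → 𝕜} (σ : Equiv.Perm (Fin n))
      (hΦ : ExpressibleByDeltaFD 𝕜 G n Φ) : ExpressibleByDeltaFD 𝕜 G n (fun a => Φ (a ∘ σ))
  | contract {n : ℕ} {Φ : (Fin (n + 2) → A) → 𝕜} (hΦ : ExpressibleByDeltaFD 𝕜 G (n + 2) Φ) :
      ExpressibleByDeltaFD 𝕜 G n (fun a => ∑ e : A, Φ (Fin.append a ![e, e]))

/-- `Φ(g X_1 g⁻¹, …, g X_n g⁻¹) = Φ(X_1, …, X_n)` for all `g ∈ GL(N, ℂ)`. -/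
def IsAdInvariantGL {N n : ℕ}
    (Φ : MultilinearMap ℂ (fun _ : Fin n => Matrix (Fin N) (Fin N) ℂ) ℂ) : Prop :=
  ∀ (g : GL (Fin N) ℂ) (X : Fin n → Matrix (Fin N) (Fin N) ℂ),
    Φ (fun i => (g : Matrix (Fin N) (Fin N) ℂ) * X i * ((g⁻¹ : GL (Fin N) ℂ) : Matrix _ _ ℂ)) = Φ X

/-- `Φ(U X_1 U⁻¹, …, U X_n U⁻¹) = Φ(X_1, …, X_n)` for all `U ∈ U(N)`, where `U⁻¹ = U^*`. -/
def IsAdInvariantU {N n : ℕ} (Φ : MultilinearMap ℝ (fun _ : Fin n => UnitaryLie N) ℝ) : Prop :=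
  ∀ (U : Matrix.unitaryGroup (Fin N) ℂ) (X : Fin n → UnitaryLie N),
    Φ (fun i => ⟨(U : Matrix (Fin N) (Fin N) ℂ) * (X i : Matrix (Fin N) (Fin N) ℂ) *
      star (U : Matrix (Fin N) (Fin N) ℂ), skewAdjoint.conjugate (X i).2 _⟩) = Φ X

/-- From the components `Φ^{a_1 … a_n}` in the extended basis, the components in which the slots
outside the range of `e` carry the index `0` and the slot `e j` carries the `su(N)` index `b_j`. -/
noncomputable def suComponents {𝕜 : Type} {N n k : ℕ}
    (Φ : (Fin n → Option (Fin (N ^ 2 - 1))) → 𝕜) (e : Fin k ↪ Fin n) :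
    (Fin k → Fin (N ^ 2 - 1)) → 𝕜 :=
  fun b => Φ (Function.extend e (fun j => some (b j)) (fun _ => none))

open Finset in
theorem exists_perm_of_map_univ_eq {ι V : Type*} [Fintype ι] {v w : ι → V}
    (h : univ.val.map v = univ.val.map w) : ∃ σ : Equiv.Perm ι, w ∘ σ = v := by
  classical
  have hcard : ∀ y, Fintype.card {x // v x = y} = Fintype.card {x // w x = y} := by
    intro y
    have := congrArg (Multiset.count y) h
    simp only [Multiset.count_map] at this
    rw [Fintype.card_subtype, Fintype.card_subtype]
    simpa [Finset.card_def, Finset.filter_val, eq_comm] using this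
  let e : Equiv.Perm ι := (Equiv.sigmaFiberEquiv v).symm.trans
    ((Equiv.sigmaCongrRight fun y => Fintype.equivOfCardEq (hcard y)).trans
      (Equiv.sigmaFiberEquiv w))
  refine ⟨e, funext fun x => ?_⟩
  exact ((Fintype.equivOfCardEq (hcard (v x))) ⟨x, rfl⟩).2

theorem MvPolynomial.algHom_aeval_eq_eval {σ R S : Type*} [CommSemiring R] [CommSemiring S]
    [Algebra R S] (φ : S →ₐ[R] R) (f : σ → S) (p : MvPolynomial σ R) :
    φ (MvPolynomial.aeval f p) = MvPolynomial.eval (fun i => φ (f i)) p := by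
  rw [MvPolynomial.comp_aeval_apply]
  rfl

section FirstFundamentalTheorem

variable {N n : ℕ}

/-- The components of a multilinear form on matrices with respect to the matrix units. -/
def unitComponents (Ψ : MultilinearMap ℂ (fun _ : Fin n => Matrix (Fin N) (Fin N) ℂ) ℂ)
    (I J : Fin n → Fin N) : ℂ :=
  Ψ fun k => Matrix.single (I k) (J k) 1

theorem multilinear_eq_sum_unitComponents
    (Ψ : MultilinearMap ℂ (fun _ : Fin n => Matrix (Fin N) (Fin N) ℂ) ℂ)
    (X : Fin n → Matrix (Fin N) (Fin N) ℂ) :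
    Ψ X = ∑ I : Fin n → Fin N, ∑ J : Fin n → Fin N,
      (∏ k, X k (I k) (J k)) * unitComponents Ψ I J := by
  have h : X = fun k => ∑ i : Fin N, ∑ j : Fin N, X k i j • Matrix.single i j (1 : ℂ) := by
    funext k
    conv_lhs => rw [Matrix.matrix_eq_sum_single (X k)]
    simp [Matrix.smul_single]
  conv_lhs => rw [h]
  rw [Ψ.map_sum]
  refine Finset.sum_congr rfl fun I _ => ?_
  rw [Ψ.map_sum]
  refine Finset.sum_congr rfl fun J _ => ?_
  rw [Ψ.map_smul_univ, smul_eq_mul]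
  rfl

/-- Invariance of a multilinear form under conjugation by unitary matrices. -/
def IsUnitaryInvariant
    (Ψ : MultilinearMap ℂ (fun _ : Fin n => Matrix (Fin N) (Fin N) ℂ) ℂ) : Prop :=
  ∀ U ∈ Matrix.unitaryGroup (Fin N) ℂ, ∀ X : Fin n → Matrix (Fin N) (Fin N) ℂ,
    Ψ (fun k => U * X k * star U) = Ψ X

/-- The components of `Ψ (X Y_k) - Ψ (Y_k X)` for matrix units `Y_k`, as polynomials in `X`. -/
noncomputable def commutatorPoly
    (Ψ : MultilinearMap ℂ (fun _ : Fin n => Matrix (Fin N) (Fin N) ℂ) ℂ)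
    (I J : Fin n → Fin N) : MvPolynomial (Fin N × Fin N) ℂ :=
  ∑ A : Fin n → Fin N, (unitComponents Ψ A J) • ∏ k, MvPolynomial.X (A k, I k) -
    ∑ B : Fin n → Fin N, (unitComponents Ψ I B) • ∏ k, MvPolynomial.X (J k, B k)

theorem eval_commutatorPoly
    (Ψ : MultilinearMap ℂ (fun _ : Fin n => Matrix (Fin N) (Fin N) ℂ) ℂ)
    (I J : Fin n → Fin N) (X : Matrix (Fin N) (Fin N) ℂ) :
    MvPolynomial.eval (fun ij => X ij.1 ij.2) (commutatorPoly Ψ I J) =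
      Ψ (fun k => X * Matrix.single (I k) (J k) 1) -
        Ψ (fun k => Matrix.single (I k) (J k) 1 * X) := by
  have h1 : (fun k => X * Matrix.single (I k) (J k) (1 : ℂ)) =
      fun k => ∑ a : Fin N, X a (I k) • Matrix.single a (J k) (1 : ℂ) := by
    funext k
    ext a b
    simp [Matrix.sum_apply, Matrix.mul_apply, Matrix.single_apply, ite_and]
  have h2 : (fun k => Matrix.single (I k) (J k) (1 : ℂ) * X) =
      fun k => ∑ b : Fin N, X (J k) b • Matrix.single (I k) b (1 : ℂ) := by
    funext k
    ext a b
    simp [Matrix.sum_apply, Matrix.mul_apply, Matrix.single_apply, ite_and]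
  rw [h1, h2, Ψ.map_sum, Ψ.map_sum]
  simp only [Ψ.map_smul_univ, commutatorPoly, map_sub, map_sum, MvPolynomial.smul_eval, map_prod,
    MvPolynomial.eval_X, smul_eq_mul, unitComponents, mul_comm]

theorem eval_commutatorPoly_unitary
    {Ψ : MultilinearMap ℂ (fun _ : Fin n => Matrix (Fin N) (Fin N) ℂ) ℂ}
    (hΨ : IsUnitaryInvariant Ψ) (I J : Fin n → Fin N) {U : Matrix (Fin N) (Fin N) ℂ}
    (hU : U ∈ Matrix.unitaryGroup (Fin N) ℂ) :
    MvPolynomial.eval (fun ij => U ij.1 ij.2) (commutatorPoly Ψ I J) = 0 := by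
  rw [eval_commutatorPoly, sub_eq_zero, ← hΨ U hU fun k => Matrix.single (I k) (J k) 1 * U]
  congr 1
  funext k
  simp [mul_assoc, (Matrix.mem_unitaryGroup_iff).1 hU]

theorem infinite_sphere_complex : (Metric.sphere (0 : ℂ) 1).Infinite := by
  have h : IsPreconnected (Metric.sphere (0 : ℂ) 1) :=
    isPreconnected_sphere (by simp [Complex.rank_real_complex]) 0 1
  refine (h.infinite_of_nontrivial ⟨1, by simp, -1, by simp, ?_⟩)
  norm_num [eq_neg_iff_add_eq_zero]

theorem eval_commutatorPoly_isHermitian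
    {Ψ : MultilinearMap ℂ (fun _ : Fin n => Matrix (Fin N) (Fin N) ℂ) ℂ}
    (hΨ : IsUnitaryInvariant Ψ) (I J : Fin n → Fin N) {X : Matrix (Fin N) (Fin N) ℂ}
    (hX : X.IsHermitian) :
    MvPolynomial.eval (fun ij => X ij.1 ij.2) (commutatorPoly Ψ I J) = 0 := by
  set V := hX.eigenvectorUnitary
  let D : (Fin N → ℂ) → Matrix (Fin N) (Fin N) ℂ := fun z =>
    (V : Matrix (Fin N) (Fin N) ℂ) * Matrix.diagonal z * star (V : Matrix (Fin N) (Fin N) ℂ)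
  let q : MvPolynomial (Fin N) ℂ := MvPolynomial.aeval
    (fun ij : Fin N × Fin N => ∑ k, MvPolynomial.C ((V : Matrix (Fin N) (Fin N) ℂ) ij.1 k *
      star ((V : Matrix (Fin N) (Fin N) ℂ) ij.2 k)) * MvPolynomial.X k) (commutatorPoly Ψ I J)
  have hq : ∀ z, MvPolynomial.eval z q =
      MvPolynomial.eval (fun ij => D z ij.1 ij.2) (commutatorPoly Ψ I J) := by
    intro z
    refine (MvPolynomial.algHom_aeval_eq_eval (MvPolynomial.aeval z) _ _).trans ?_
    congr 2
    funext ij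
    simp only [map_sum, map_mul, MvPolynomial.aeval_C, MvPolynomial.aeval_X, Algebra.algebraMap_self,
      RingHom.id_apply, D]
    rw [Matrix.mul_apply]
    refine Finset.sum_congr rfl fun k _ => ?_
    rw [Matrix.mul_diagonal, Matrix.star_apply]
    ring
  have hq0 : q = 0 := by
    refine MvPolynomial.funext_set (fun _ => Metric.sphere (0 : ℂ) 1) (fun _ => ?_) ?_
    · exact infinite_sphere_complex
    · intro z hz
      rw [hq, map_zero]
      refine eval_commutatorPoly_unitary hΨ I J ?_
      have hd : Matrix.diagonal z ∈ Matrix.unitaryGroup (Fin N) ℂ := by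
        rw [Matrix.mem_unitaryGroup_iff, Matrix.star_eq_conjTranspose,
          Matrix.diagonal_conjTranspose, Matrix.diagonal_mul_diagonal, ← Matrix.diagonal_one]
        congr 1
        funext i
        have := hz i (Set.mem_univ _)
        simp only [mem_sphere_iff_norm, sub_zero] at this
        simp [Complex.mul_conj, Complex.normSq_eq_norm_sq, this]
      exact mul_mem (mul_mem V.2 hd) (star V).2
  have hs := hX.spectral_theorem
  have := hq (RCLike.ofReal ∘ hX.eigenvalues)
  rw [hq0, map_zero] at this
  refine Eq.trans ?_ this.symm
  congr 2
  funext ij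
  exact congrFun (congrFun (hs.trans (Unitary.conjStarAlgAut_apply _ _)) ij.1) ij.2

theorem commutatorPoly_eq_zero
    {Ψ : MultilinearMap ℂ (fun _ : Fin n => Matrix (Fin N) (Fin N) ℂ) ℂ}
    (hΨ : IsUnitaryInvariant Ψ) (I J : Fin n → Fin N) : commutatorPoly Ψ I J = 0 := by
  refine MvPolynomial.funext fun x => ?_
  let X : Matrix (Fin N) (Fin N) ℂ := Matrix.of fun i j => x (i, j)
  let Y : Matrix (Fin N) (Fin N) ℂ := realPart X
  let Z : Matrix (Fin N) (Fin N) ℂ := imaginaryPart X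
  have hYZ : X = Y + Complex.I • Z := (realPart_add_I_smul_imaginaryPart X).symm
  let q : Polynomial ℂ := MvPolynomial.aeval
    (fun ij : Fin N × Fin N => Polynomial.C (Y ij.1 ij.2) +
      Polynomial.X * Polynomial.C (Z ij.1 ij.2)) (commutatorPoly Ψ I J)
  have hq : ∀ z, q.eval z = MvPolynomial.eval (fun ij => (Y + z • Z) ij.1 ij.2)
      (commutatorPoly Ψ I J) := by
    intro z
    refine (MvPolynomial.algHom_aeval_eq_eval (Polynomial.aeval z) _ _).trans ?_
    congr 2
    funext ij
    simp only [map_add, map_mul, Polynomial.aeval_C, Polynomial.aeval_X, Algebra.algebraMap_self,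
      RingHom.id_apply, Matrix.add_apply, Matrix.smul_apply, smul_eq_mul]
  have hq0 : q = 0 := by
    refine Polynomial.eq_zero_of_infinite_isRoot q
      ((Set.infinite_range_of_injective Complex.ofReal_injective).mono ?_)
    rintro _ ⟨t, rfl⟩
    rw [Set.mem_ofPred_eq, Polynomial.IsRoot, hq]
    refine eval_commutatorPoly_isHermitian hΨ I J ?_
    have hY : IsSelfAdjoint Y := (realPart X).2
    have hZ : IsSelfAdjoint Z := (imaginaryPart X).2
    have : IsSelfAdjoint (Y + (t : ℂ) • Z) := hY.add (IsSelfAdjoint.smul (by simp [isSelfAdjoint_iff]) hZ)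
    exact this
  have := hq Complex.I
  rw [hq0, Polynomial.eval_zero, ← hYZ] at this
  rw [map_zero]
  exact this.symm

open Finset in
/-- Components of a unitarily invariant form commute with the matrices on multi-indices that are
invariant under permutations of the slots. -/
theorem unitComponents_commute
    {Ψ : MultilinearMap ℂ (fun _ : Fin n => Matrix (Fin N) (Fin N) ℂ) ℂ}
    (hΨ : IsUnitaryInvariant Ψ) {M : Matrix (Fin n → Fin N) (Fin n → Fin N) ℂ}
    (hM : ∀ (σ : Equiv.Perm (Fin n)) (I J), M (I ∘ σ) (J ∘ σ) = M I J) :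
    (Matrix.of (unitComponents Ψ)).transpose * M = M * (Matrix.of (unitComponents Ψ)).transpose := by
  classical
  let s : (Fin n → Fin N) → (Fin n → Fin N) → (Fin N × Fin N →₀ ℕ) := fun I J =>
    Multiset.toFinsupp (univ.val.map fun k => (I k, J k))
  have hs : ∀ I J I' J', s I J = s I' J' → M I J = M I' J' := by
    intro I J I' J' h
    obtain ⟨σ, hσ⟩ := exists_perm_of_map_univ_eq (Multiset.toFinsupp.injective h)
    have h1 : I' ∘ σ = I := funext fun k => congrArg Prod.fst (congrFun hσ k)
    have h2 : J' ∘ σ = J := funext fun k => congrArg Prod.snd (congrFun hσ k)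
    rw [← h1, ← h2, hM]
  let M' : (Fin N × Fin N →₀ ℕ) → ℂ := Function.extend (fun IJ : _ × _ => s IJ.1 IJ.2)
    (fun IJ => M IJ.1 IJ.2) 0
  have hM' : ∀ I J, M' (s I J) = M I J := by
    intro I J
    have : Function.FactorsThrough (fun IJ : (Fin n → Fin N) × (Fin n → Fin N) => M IJ.1 IJ.2)
        (fun IJ => s IJ.1 IJ.2) := fun a b h => hs _ _ _ _ h
    exact this.extend_apply 0 (I, J)
  let L : MvPolynomial (Fin N × Fin N) ℂ →ₗ[ℂ] ℂ :=
    (MvPolynomial.basisMonomials (Fin N × Fin N) ℂ).constr ℂ M'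
  have hL : ∀ I J : Fin n → Fin N, L (∏ k, MvPolynomial.X (I k, J k)) = M I J := by
    intro I J
    have : (∏ k, MvPolynomial.X (I k, J k) : MvPolynomial (Fin N × Fin N) ℂ) =
        MvPolynomial.basisMonomials _ _ (s I J) := by
      have h : s I J = ∑ k, Finsupp.single (I k, J k) 1 := by
        simp only [← Multiset.toFinsupp_singleton, ← map_sum]
        simp only [s, Finset.sum]
        rw [← Multiset.sum_map_singleton (univ.val.map fun k => (I k, J k)), Multiset.map_map]
        rfl
      rw [MvPolynomial.coe_basisMonomials, h]
      dsimp only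
      rw [MvPolynomial.monomial_sum_one]
      rfl
    rw [this, Module.Basis.constr_basis, hM']
  ext J I
  have := congrArg L (commutatorPoly_eq_zero hΨ I J)
  simp only [commutatorPoly, map_sub, map_sum, map_smul, hL, smul_eq_mul, map_zero,
    sub_eq_zero] at this
  simp only [Matrix.mul_apply, Matrix.transpose_apply, Matrix.of_apply]
  rw [this]
  exact Finset.sum_congr rfl fun _ _ => mul_comm _ _

/-- The matrix on multi-indices that permutes the slots by `σ`. -/
def slotPermMatrix (N : ℕ) {n : ℕ} (σ : Equiv.Perm (Fin n)) :
    Matrix (Fin n → Fin N) (Fin n → Fin N) ℂ :=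
  Matrix.of fun J I => if J = I ∘ σ then 1 else 0

theorem slotPermMatrix_one : slotPermMatrix N (1 : Equiv.Perm (Fin n)) = 1 := by
  ext J I
  simp [slotPermMatrix, Matrix.one_apply]

theorem slotPermMatrix_mul_apply (σ : Equiv.Perm (Fin n)) {κ : Type*}
    (X : Matrix (Fin n → Fin N) κ ℂ) (J : Fin n → Fin N) (k : κ) :
    (slotPermMatrix N σ * X) J k = X (J ∘ σ.symm) k := by
  have : ∀ I : Fin n → Fin N, J = I ∘ σ ↔ I = J ∘ σ.symm := fun I =>
    ⟨fun h => by rw [h]; ext; simp, fun h => by rw [h]; ext; simp⟩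
  simp [Matrix.mul_apply, slotPermMatrix, this]

theorem slotPermMatrix_mul (σ τ : Equiv.Perm (Fin n)) :
    slotPermMatrix N σ * slotPermMatrix N τ = slotPermMatrix N (τ * σ) := by
  have : ∀ J I : Fin n → Fin N, J ∘ σ.symm = I ∘ τ ↔ J = (I ∘ τ) ∘ σ := fun J I =>
    ⟨fun h => by rw [← h]; ext; simp, fun h => by rw [h]; ext; simp⟩
  ext J I
  rw [slotPermMatrix_mul_apply]
  simp only [slotPermMatrix, Matrix.of_apply, this]
  rfl

/-- The double commutant theorem for the slot permutations. -/
theorem mem_span_slotPermMatrix {P : Matrix (Fin n → Fin N) (Fin n → Fin N) ℂ}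
    (hP : ∀ M : Matrix (Fin n → Fin N) (Fin n → Fin N) ℂ,
      (∀ (σ : Equiv.Perm (Fin n)) (I J), M (I ∘ σ) (J ∘ σ) = M I J) → P * M = M * P) :
    P ∈ Submodule.span ℂ (Set.range (slotPermMatrix N (n := n))) := by
  set S := Submodule.span ℂ (Set.range (slotPermMatrix N (n := n)))
  obtain ⟨E₀, hE₀⟩ := S.subtype.exists_leftInverse_of_injective S.ker_subtype
  let E : Matrix (Fin n → Fin N) (Fin n → Fin N) ℂ →ₗ[ℂ] Matrix (Fin n → Fin N) (Fin n → Fin N) ℂ :=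
    ((Fintype.card (Equiv.Perm (Fin n)) : ℂ)⁻¹) • ∑ σ : Equiv.Perm (Fin n),
      LinearMap.mulLeft ℂ (slotPermMatrix N σ) ∘ₗ S.subtype ∘ₗ E₀ ∘ₗ
        LinearMap.mulLeft ℂ (slotPermMatrix N σ⁻¹)
  have hE : ∀ X, E X = ((Fintype.card (Equiv.Perm (Fin n)) : ℂ)⁻¹) •
      ∑ σ : Equiv.Perm (Fin n), slotPermMatrix N σ * (E₀ (slotPermMatrix N σ⁻¹ * X) : Matrix _ _ ℂ) := by
    intro X
    simp [E, LinearMap.sum_apply]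
  have hmulS : ∀ σ, ∀ X ∈ S, slotPermMatrix N σ * X ∈ S := by
    intro σ X hX
    induction hX using Submodule.span_induction with
    | mem x hx =>
      obtain ⟨τ, rfl⟩ := hx
      rw [slotPermMatrix_mul]
      exact Submodule.subset_span ⟨_, rfl⟩
    | zero => simp
    | add x y _ _ hx hy => rw [mul_add]; exact S.add_mem hx hy
    | smul a x _ hx => rw [mul_smul_comm]; exact S.smul_mem a hx
  have hE_mem : ∀ X, E X ∈ S := by
    intro X
    rw [hE]
    exact S.smul_mem _ (S.sum_mem fun σ _ => hmulS σ _ (E₀ _).2)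
  have hE_one : E 1 = 1 := by
    have : ∀ σ : Equiv.Perm (Fin n), slotPermMatrix N σ *
        (E₀ (slotPermMatrix N σ⁻¹ * 1) : Matrix _ _ ℂ) = 1 := by
      intro σ
      have h := LinearMap.congr_fun hE₀ ⟨slotPermMatrix N σ⁻¹, Submodule.subset_span ⟨_, rfl⟩⟩
      simp only [LinearMap.comp_apply, Submodule.subtype_apply, LinearMap.id_apply] at h
      rw [mul_one, h, slotPermMatrix_mul, inv_mul_cancel, slotPermMatrix_one]
    rw [hE]
    simp only [this, Finset.sum_const, Finset.card_univ]
    rw [← Nat.cast_smul_eq_nsmul ℂ, smul_smul, inv_mul_cancel₀ (by simp [Fintype.card_ne_zero]),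
      one_smul]
  have hE_comm : ∀ τ X, E (slotPermMatrix N τ * X) = slotPermMatrix N τ * E X := by
    intro τ X
    rw [hE, hE, mul_smul_comm, Finset.mul_sum]
    congr 1
    refine Fintype.sum_equiv (Equiv.mulRight τ⁻¹) _ _ fun σ => ?_
    simp only [Equiv.coe_mulRight, ← mul_assoc, slotPermMatrix_mul]
    simp
  have hE_P : E P = P * E 1 := by
    let e : (Fin n → Fin N) → (Fin n → Fin N) → Matrix (Fin n → Fin N) (Fin n → Fin N) ℂ :=
      fun j k => Matrix.of fun i l => E (Matrix.single l k 1) i j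
    have hXe : ∀ X i j, E X i j = ∑ k, (e j k * X) i k := by
      intro X i j
      conv_lhs => rw [Matrix.matrix_eq_sum_single X]
      simp only [map_sum, Matrix.sum_apply, Matrix.mul_apply, e, Matrix.of_apply]
      rw [Finset.sum_comm]
      refine Finset.sum_congr rfl fun k _ => Finset.sum_congr rfl fun l _ => ?_
      rw [show Matrix.single l k (X l k) = X l k • Matrix.single l k (1 : ℂ) by
        simp [Matrix.smul_single], map_smul, Matrix.smul_apply, smul_eq_mul, mul_comm]
    have he : ∀ j k, P * e j k = e j k * P := by
      intro j k
      refine hP _ fun σ I J => ?_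
      have h1 : Matrix.single (J ∘ σ) k (1 : ℂ) = slotPermMatrix N σ * Matrix.single J k 1 := by
        ext A B
        have : J ∘ σ = A ↔ J = A ∘ σ.symm :=
          ⟨fun h => by rw [← h]; ext; simp, fun h => by rw [h]; ext; simp⟩
        rw [slotPermMatrix_mul_apply]
        simp only [Matrix.single_apply, this]
      simp only [e, Matrix.of_apply]
      rw [h1, hE_comm, slotPermMatrix_mul_apply]
      rw [show (I ∘ σ) ∘ σ.symm = I by ext; simp]
    ext i j
    rw [hXe]
    have : ∀ k, (e j k * P) i k = ∑ l, P i l * e j k l k := by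
      intro k
      rw [← he, Matrix.mul_apply]
    rw [Matrix.mul_apply, Finset.sum_congr rfl fun k _ => this k, Finset.sum_comm]
    refine Finset.sum_congr rfl fun l _ => ?_
    rw [hXe, Finset.mul_sum]
    exact Finset.sum_congr rfl fun k _ => by rw [Matrix.mul_one]
  rw [hE_one, mul_one] at hE_P
  rw [← hE_P]
  exact hE_mem P

/-- The invariant attached to a permutation: the product over its cycles of traces of products. -/
def permInvariant (σ : Equiv.Perm (Fin n)) (X : Fin n → Matrix (Fin N) (Fin N) ℂ) : ℂ :=
  ∑ I : Fin n → Fin N, ∏ k, X k (I k) (I (σ k))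

/-- First fundamental theorem: a unitarily invariant multilinear form is a linear combination of
products of traces. -/
theorem IsUnitaryInvariant.exists_eq_sum_permInvariant
    {Ψ : MultilinearMap ℂ (fun _ : Fin n => Matrix (Fin N) (Fin N) ℂ) ℂ}
    (hΨ : IsUnitaryInvariant Ψ) :
    ∃ r : Equiv.Perm (Fin n) → ℂ, ∀ X, Ψ X = ∑ σ, r σ * permInvariant σ X := by
  have h := mem_span_slotPermMatrix (P := (Matrix.of (unitComponents Ψ)).transpose)
    fun M hM => unitComponents_commute hΨ hM
  obtain ⟨r, hr⟩ := (Submodule.mem_span_range_iff_exists_fun ℂ).1 h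
  refine ⟨r, fun X => ?_⟩
  have hu : ∀ I J, unitComponents Ψ I J = ∑ σ, r σ * if J = I ∘ σ then 1 else 0 := by
    intro I J
    have := congrFun (congrFun hr J) I
    simpa [Matrix.sum_apply, slotPermMatrix] using this.symm
  rw [multilinear_eq_sum_unitComponents]
  simp only [hu, Finset.mul_sum, permInvariant]
  rw [Finset.sum_comm (s := Finset.univ (α := Equiv.Perm (Fin n)))]
  refine Finset.sum_congr rfl fun I _ => ?_
  rw [Finset.sum_comm]
  refine Finset.sum_congr rfl fun σ _ => ?_
  simp [mul_comm]

end FirstFundamentalTheorem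

section NamedIndices

variable {N : ℕ} {A : Type} [Fintype A] [DecidableEq A]

/-- `ExpressibleIn G s Φ`: the array `Φ`, a function of an assignment `V → A` of values to named
indices, is expressible through the symbols of `G`, with the free indices listed in `s`. A name
that is repeated in `s` stands for a diagonal evaluation. -/
def ExpressibleIn (G : A → Matrix (Fin N) (Fin N) ℂ) {V : Type} (s : Multiset V)
    (Φ : (V → A) → ℂ) : Prop :=
  ∃ (m : ℕ) (v : Fin m → V) (Ψ : (Fin m → A) → ℂ), ExpressibleByDeltaFD ℂ G m Ψ ∧
    Finset.univ.val.map v = s ∧ ∀ a, Φ a = Ψ (a ∘ v)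

variable {G : A → Matrix (Fin N) (Fin N) ℂ} {V : Type}

theorem ExpressibleIn.congr {s : Multiset V} {Φ Φ' : (V → A) → ℂ} (h : ExpressibleIn G s Φ)
    (h' : ∀ a, Φ' a = Φ a) : ExpressibleIn G s Φ' :=
  funext h' ▸ h

/-- The legs of an expressible array can be put into any order. -/
theorem ExpressibleIn.exists_along {m : ℕ} {w : Fin m → V} {Φ : (V → A) → ℂ}
    (h : ExpressibleIn G (Finset.univ.val.map w) Φ) :
    ∃ Ψ : (Fin m → A) → ℂ, ExpressibleByDeltaFD ℂ G m Ψ ∧ ∀ a, Φ a = Ψ (a ∘ w) := by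
  obtain ⟨k, v, Ψ, hΨ, hv, hΦ⟩ := h
  have hk : k = m := by simpa using congrArg Multiset.card hv
  subst hk
  obtain ⟨σ, hσ⟩ := exists_perm_of_map_univ_eq hv
  exact ⟨_, hΨ.perm σ, fun a => by rw [hΦ, ← hσ]; rfl⟩

theorem exists_map_univ_eq (s : Multiset V) :
    ∃ (m : ℕ) (w : Fin m → V), Finset.univ.val.map w = s :=
  ⟨s.toList.length, s.toList.get, by rw [Fin.univ_val_map, List.ofFn_get, Multiset.coe_toList]⟩

theorem ExpressibleIn.add {s : Multiset V} {Φ Ψ : (V → A) → ℂ} (hΦ : ExpressibleIn G s Φ)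
    (hΨ : ExpressibleIn G s Ψ) : ExpressibleIn G s (fun a => Φ a + Ψ a) := by
  obtain ⟨m, w, rfl⟩ := exists_map_univ_eq s
  obtain ⟨Φ', h1, h2⟩ := hΦ.exists_along
  obtain ⟨Ψ', h3, h4⟩ := hΨ.exists_along
  exact ⟨m, w, _, h1.add h3, rfl, fun a => by simp only [h2, h4]⟩

theorem ExpressibleIn.const_mul {s : Multiset V} {Φ : (V → A) → ℂ} (r : ℂ)
    (hΦ : ExpressibleIn G s Φ) : ExpressibleIn G s (fun a => r * Φ a) := by
  obtain ⟨m, w, Φ', h1, h2, h3⟩ := hΦ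
  exact ⟨m, w, _, h1.smul r, h2, fun a => by simp only [h3]⟩

theorem ExpressibleIn.mul {s t : Multiset V} {Φ Ψ : (V → A) → ℂ} (hΦ : ExpressibleIn G s Φ)
    (hΨ : ExpressibleIn G t Ψ) : ExpressibleIn G (s + t) (fun a => Φ a * Ψ a) := by
  obtain ⟨m, v, Φ', h1, h2, h3⟩ := hΦ
  obtain ⟨k, w, Ψ', h4, h5, h6⟩ := hΨ
  refine ⟨m + k, Fin.append v w, _, h1.prod h4, ?_, fun a => ?_⟩
  · rw [← h2, ← h5]
    simp [List.ofFn_fin_append]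
  · simp only [h3, h6]
    congr 2 <;> funext i <;> simp

theorem ExpressibleIn.const (r : ℂ) : ExpressibleIn G (0 : Multiset V) (fun _ => r) :=
  ⟨0, Fin.elim0, _, ExpressibleByDeltaFD.one.smul r, rfl, fun _ => by simp⟩

theorem ExpressibleIn.prod {ι : Type*} (t : Finset ι) {s : ι → Multiset V}
    {Φ : ι → (V → A) → ℂ} (h : ∀ i ∈ t, ExpressibleIn G (s i) (Φ i)) :
    ExpressibleIn G (∑ i ∈ t, s i) (fun a => ∏ i ∈ t, Φ i a) := by
  classical
  induction t using Finset.induction_on with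
  | empty => simpa using ExpressibleIn.const (1 : ℂ)
  | insert i t hi ih =>
    simp only [Finset.sum_insert hi, Finset.prod_insert hi]
    exact (h i (Finset.mem_insert_self i t)).mul
      (ih fun j hj => h j (Finset.mem_insert_of_mem hj))

theorem ExpressibleIn.of_legs {m : ℕ} {Ψ : (Fin m → A) → ℂ}
    (h : ExpressibleByDeltaFD ℂ G m Ψ) (v : Fin m → V) :
    ExpressibleIn G (Finset.univ.val.map v) (fun a => Ψ (a ∘ v)) :=
  ⟨m, v, Ψ, h, rfl, fun _ => rfl⟩

/-- Contraction of the index `none`, which occurs twice. -/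
theorem ExpressibleIn.contract {s : Multiset V} {Φ : (Option V → A) → ℂ}
    (h : ExpressibleIn G (none ::ₘ none ::ₘ s.map some) Φ) :
    ExpressibleIn G s (fun a => ∑ e, Φ (fun o => o.elim e a)) := by
  obtain ⟨m, w, rfl⟩ := exists_map_univ_eq s
  have hs : Finset.univ.val.map (Fin.append (some ∘ w) ![none, none]) =
      none ::ₘ none ::ₘ (Finset.univ.val.map w).map some := by
    rw [Fin.univ_val_map, List.ofFn_fin_append, ← Multiset.coe_add, ← Fin.univ_val_map,
      Multiset.map_map, add_comm]
    rfl
  rw [← hs] at h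
  obtain ⟨Ψ, h1, h2⟩ := h.exists_along
  refine ⟨m, w, _, h1.contract, rfl, fun a => Finset.sum_congr rfl fun e _ => ?_⟩
  rw [h2]
  congr 1
  funext i
  refine Fin.addCases (fun j => ?_) (fun j => ?_) i
  · simp
  · fin_cases j <;> simp

theorem ExpressibleIn.expressible {m : ℕ} {Φ : (Fin m → A) → ℂ}
    (h : ExpressibleIn G (Finset.univ.val) Φ) : ExpressibleByDeltaFD ℂ G m Φ := by
  rw [← Multiset.map_id' (Finset.univ.val : Multiset (Fin m))] at h
  obtain ⟨Ψ, h1, h2⟩ := h.exists_along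
  have : Φ = Ψ := funext h2
  exact this ▸ h1

end NamedIndices

/-- Real and imaginary parts of arrays expressible over `ℂ` are expressible over `ℝ`. -/
theorem ExpressibleByDeltaFD.re_im {N : ℕ} {A : Type} [Fintype A] [DecidableEq A]
    {G : A → Matrix (Fin N) (Fin N) ℂ} {n : ℕ} {Φ : (Fin n → A) → ℂ}
    (h : ExpressibleByDeltaFD ℂ G n Φ) :
    ExpressibleByDeltaFD ℝ G n (fun a => (Φ a).re) ∧
      ExpressibleByDeltaFD ℝ G n (fun a => (Φ a).im) := by
  have zero : ∀ {n : ℕ} {Φ : (Fin n → A) → ℝ}, ExpressibleByDeltaFD ℝ G n Φ →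
      ExpressibleByDeltaFD ℝ G n (fun _ => 0) := fun h => by simpa using h.smul 0
  induction h with
  | one => exact ⟨by simpa using .one, by simpa using zero .one⟩
  | delta =>
    refine ⟨?_, ?_⟩
    · simpa [apply_ite Complex.re] using ExpressibleByDeltaFD.delta (𝕜 := ℝ) (G := G)
    · simpa [apply_ite Complex.im] using zero (ExpressibleByDeltaFD.delta (𝕜 := ℝ) (G := G))
  | f => exact ⟨by simpa using .f, by simpa using zero .f⟩
  | d => exact ⟨by simpa using .d, by simpa using zero .d⟩
  | add _ _ h1 h2 => exact ⟨by simpa using h1.1.add h2.1, by simpa using h1.2.add h2.2⟩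
  | smul r _ h =>
    refine ⟨?_, ?_⟩
    · simpa [sub_eq_add_neg] using (h.1.smul r.re).add ((h.2.smul r.im).smul (-1))
    · simpa using (h.2.smul r.re).add (h.1.smul r.im)
  | prod _ _ h1 h2 =>
    refine ⟨?_, ?_⟩
    · simpa [sub_eq_add_neg] using (h1.1.prod h2.1).add ((h1.2.prod h2.2).smul (-1))
    · simpa using (h1.1.prod h2.2).add (h1.2.prod h2.1)
  | perm σ _ h => exact ⟨h.1.perm σ, h.2.perm σ⟩
  | contract _ h => exact ⟨by simpa using h.1.contract, by simpa using h.2.contract⟩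

theorem mul_apply_mul_apply_of_complete {N : ℕ} {A : Type} [Fintype A]
    {G : A → Matrix (Fin N) (Fin N) ℂ} {α β : ℂ}
    (hG : ∀ X : Matrix (Fin N) (Fin N) ℂ,
      α • ∑ e, (X * G e).trace • G e + (β * X.trace) • 1 = X) (X Y : Matrix (Fin N) (Fin N) ℂ)
    (i j r s : Fin N) :
    X i s * Y j r =
      α * ∑ e, (X * G e) i r * (Y * G e) j s + β * (X i r * Y j s) := by
  have h := congrArg (fun Z : Matrix (Fin N) (Fin N) ℂ => (Y * Z) j s)
    (hG (Matrix.single r i 1 * X))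
  have h1 : ∀ Z : Matrix (Fin N) (Fin N) ℂ, (Matrix.single r i 1 * Z).trace = Z i r := by
    intro Z
    simp [Matrix.trace, Matrix.mul_apply, Matrix.single_apply, ite_and]
  have h2 : (Y * (Matrix.single r i (1 : ℂ) * X) : Matrix (Fin N) (Fin N) ℂ) j s =
      X i s * Y j r := by
    rw [← mul_assoc]
    simp [Matrix.mul_apply, Matrix.single_apply, ite_and, mul_comm]
  rw [← h2]
  refine h.symm.trans ?_
  simp only [mul_assoc, h1, mul_add, Matrix.mul_smul, Matrix.mul_sum, Matrix.mul_one,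
    Matrix.add_apply, Matrix.smul_apply, Matrix.sum_apply, smul_eq_mul]

/-- Matrix families that satisfy a completeness relation and whose traces of products of up to
three members are expressible through their own symbols. -/
structure IsSymbolComplete {N : ℕ} {A : Type} [Fintype A] [DecidableEq A]
    (G : A → Matrix (Fin N) (Fin N) ℂ) (α β : ℂ) : Prop where
  complete : ∀ X : Matrix (Fin N) (Fin N) ℂ,
    α • ∑ e, (X * G e).trace • G e + (β * X.trace) • 1 = X
  trace_one : ExpressibleByDeltaFD ℂ G 1 (fun a => (G (a 0)).trace)
  trace_two : ExpressibleByDeltaFD ℂ G 2 (fun a => (G (a 0) * G (a 1)).trace)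
  trace_three : ExpressibleByDeltaFD ℂ G 3 (fun a => (G (a 0) * G (a 1) * G (a 2)).trace)

namespace IsSymbolComplete

variable {N : ℕ} {A : Type} [Fintype A] [DecidableEq A] {G : A → Matrix (Fin N) (Fin N) ℂ}
  {α β : ℂ}

theorem trace_mul (hG : IsSymbolComplete G α β) (X Y : Matrix (Fin N) (Fin N) ℂ) :
    (X * Y).trace = α * ∑ e, (X * G e).trace * (G e * Y).trace + β * (X.trace * Y.trace) := by
  conv_lhs => rw [← hG.complete X]
  simp [add_mul, Finset.sum_mul, Matrix.trace_sum, mul_assoc]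

theorem trace_word (hG : IsSymbolComplete G α β) (k : ℕ) : ∀ {V : Type} (l : List V),
    l.length = k → ExpressibleIn G (l : Multiset V)
      (fun a => ((l.map fun x => G (a x)).prod).trace) := by
  induction k using Nat.strong_induction_on with
  | _ k ih =>
  intro V l hl
  match l, hl with
  | [], _ => exact (ExpressibleIn.const (N : ℂ)).congr fun a => by simp
  | [x], _ =>
    exact (ExpressibleIn.of_legs hG.trace_one ![x]).congr fun a => by simp
  | [x, y], _ =>
    exact (ExpressibleIn.of_legs hG.trace_two ![x, y]).congr fun a => by simp
  | [x, y, z], _ =>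
    exact (ExpressibleIn.of_legs hG.trace_three ![x, y, z]).congr fun a => by
      simp [mul_assoc]
  | x :: y :: z :: w :: t, hl =>
    simp only [List.length_cons] at hl
    have h1 := (ih 3 (by omega) [some x, some y, none] rfl).mul
      (ih (k - 1) (by omega) (none :: (z :: w :: t).map some) (by simp; omega))
    have h2 : (([some x, some y, none] : List (Option V)) : Multiset (Option V)) +
        ((none :: (z :: w :: t).map some : List (Option V)) : Multiset (Option V)) =
        none ::ₘ none ::ₘ Multiset.map some ((x :: y :: z :: w :: t : List V) : Multiset V) := by
      rw [← Multiset.singleton_add, ← Multiset.singleton_add]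
      simp only [← Multiset.cons_coe, List.map_cons, ← Multiset.singleton_add,
        Multiset.coe_nil, ← Multiset.map_coe, Multiset.map_add, Multiset.map_singleton]
      abel
    rw [h2] at h1
    have h3 := (ih 2 (by omega) [x, y] rfl).mul
      (ih (k - 2) (by omega) (z :: w :: t) (by simp; omega))
    refine ((h1.contract.const_mul α).add (h3.const_mul β)).congr fun a => ?_
    have := hG.trace_mul (G (a x) * G (a y)) (((z :: w :: t).map fun x => G (a x)).prod)
    simpa [mul_assoc, Function.comp_def] using this

theorem permInvariant_swap_mul (hG : IsSymbolComplete G α β) {n : ℕ} (f : Equiv.Perm (Fin n))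
    {p q : Fin n} (hpq : p ≠ q) (X : Fin n → Matrix (Fin N) (Fin N) ℂ) :
    permInvariant (Equiv.swap (f p) (f q) * f) X =
      α * ∑ e, permInvariant f (fun k => X k * ((if k = p then G e else 1) *
        (if k = q then G e else 1))) + β * permInvariant f X := by
  have hsplit : ∀ F : Fin n → ℂ,
      ∏ k, F k = F p * F q * ∏ k ∈ (Finset.univ.erase p).erase q, F k := by
    intro F
    rw [mul_assoc, Finset.mul_prod_erase _ _ (by simp [hpq.symm]),
      Finset.mul_prod_erase _ _ (by simp)]
  simp only [permInvariant]
  rw [Finset.sum_comm, Finset.mul_sum, Finset.mul_sum, ← Finset.sum_add_distrib]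
  refine Finset.sum_congr rfl fun I _ => ?_
  rw [hsplit, hsplit, Finset.sum_congr rfl fun e _ => hsplit _]
  have h1 : ∏ k ∈ (Finset.univ.erase p).erase q,
      X k (I k) (I ((Equiv.swap (f p) (f q) * f) k)) =
        ∏ k ∈ (Finset.univ.erase p).erase q, X k (I k) (I (f k)) := by
    refine Finset.prod_congr rfl fun k hk => ?_
    simp only [Finset.mem_erase] at hk
    rw [Equiv.Perm.mul_apply, Equiv.swap_apply_of_ne_of_ne (by simp [hk.2.1]) (by simp [hk.1])]
  have h2 : ∀ e, ∏ k ∈ (Finset.univ.erase p).erase q,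
      (X k * ((if k = p then G e else 1) * (if k = q then G e else 1))) (I k) (I (f k)) =
        ∏ k ∈ (Finset.univ.erase p).erase q, X k (I k) (I (f k)) := by
    intro e
    refine Finset.prod_congr rfl fun k hk => ?_
    simp only [Finset.mem_erase] at hk
    simp [hk.1, hk.2.1]
  simp only [h1, h2]
  rw [← Finset.sum_mul]
  simp only [Equiv.Perm.mul_apply, Equiv.swap_apply_left, Equiv.swap_apply_right, if_true, hpq,
    hpq.symm, if_false, mul_one, one_mul]
  rw [mul_apply_mul_apply_of_complete hG.complete]
  ring

theorem permInvariant_word (hG : IsSymbolComplete G α β) {n : ℕ} (σ : Equiv.Perm (Fin n)) :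
    ∀ {V : Type} (w : Fin n → List V), ExpressibleIn G (∑ k, (w k : Multiset V))
      (fun a => permInvariant σ (fun k => ((w k).map fun x => G (a x)).prod)) := by
  induction σ using Equiv.Perm.swap_induction_on with
  | one =>
    intro V w
    refine (ExpressibleIn.prod Finset.univ fun k _ => hG.trace_word _ (w k) rfl).congr fun a => ?_
    simp only [permInvariant, Matrix.trace, Matrix.diag_apply, Equiv.Perm.one_apply,
      Finset.prod_univ_sum, Fintype.piFinset_univ]
  | swap_mul f x y hxy ih =>
    intro V w
    obtain ⟨p, rfl⟩ := f.surjective x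
    obtain ⟨q, rfl⟩ := f.surjective y
    have hpq : p ≠ q := fun h => hxy (by rw [h])
    have h1 := ih fun k => (w k).map some ++ ((if k = p then [none] else []) ++
      (if k = q then [none] else []))
    have h2 : ∑ k, (((w k).map some ++ ((if k = p then [none] else []) ++
        (if k = q then [none] else []) : List (Option V)) : List (Option V)) :
          Multiset (Option V)) =
        none ::ₘ none ::ₘ (∑ k, (w k : Multiset V)).map some := by
      have h3 : ∀ r : Fin n, ∑ k, (((if k = r then [none] else [] : List (Option V)) :
          Multiset (Option V))) = {none} := by
        intro r
        simp [apply_ite (fun l : List (Option V) => (l : Multiset (Option V)))]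
      simp only [← Multiset.coe_add, Finset.sum_add_distrib, h3, ← Multiset.singleton_add]
      rw [← Multiset.coe_mapAddMonoidHom, map_sum, add_comm, add_assoc]
      rfl
    rw [h2] at h1
    refine ((h1.contract.const_mul α).add ((ih w).const_mul β)).congr fun a => ?_
    rw [hG.permInvariant_swap_mul f hpq]
    congr 3
    funext e
    congr 1
    funext k
    split_ifs <;> simp [Function.comp_def]

/-- Invariant forms have expressible components. -/
theorem expressible_of_invariant (hG : IsSymbolComplete G α β) {n : ℕ}
    {Ψ : MultilinearMap ℂ (fun _ : Fin n => Matrix (Fin N) (Fin N) ℂ) ℂ}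
    (hΨ : IsUnitaryInvariant Ψ) :
    ExpressibleByDeltaFD ℂ G n (fun a => Ψ (fun i => G (a i))) := by
  obtain ⟨r, hr⟩ := hΨ.exists_eq_sum_permInvariant
  have hu : ∑ k : Fin n, (([k] : List (Fin n)) : Multiset (Fin n)) = Finset.univ.val := by
    exact Multiset.sum_map_singleton _
  have h : ∀ σ : Equiv.Perm (Fin n), ExpressibleByDeltaFD ℂ G n
      (fun a => r σ * permInvariant σ (fun k => G (a k))) := by
    intro σ
    have := hG.permInvariant_word σ fun k : Fin n => [k]
    rw [hu] at this
    simpa using this.expressible.smul (r σ)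
  have hsum : ∀ t : Finset (Equiv.Perm (Fin n)), ExpressibleByDeltaFD ℂ G n
      (fun a => ∑ σ ∈ t, r σ * permInvariant σ (fun k => G (a k))) := by
    intro t
    induction t using Finset.induction_on with
    | empty => simpa using (h 1).smul 0
    | insert σ t hσ ih => simpa [Finset.sum_insert hσ] using (h σ).add ih
  simpa [hr] using hsum Finset.univ

end IsSymbolComplete

section Symbols

variable {N : ℕ} {A : Type} {G : A → Matrix (Fin N) (Fin N) ℂ}

theorem star_trace_mul_mul (hG : ∀ a, IsSelfAdjoint (G a)) (a b c : A) :
    star (G a * G b * G c).trace = (G b * G a * G c).trace := by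
  rw [← Matrix.trace_conjTranspose, ← Matrix.star_eq_conjTranspose, star_mul, star_mul,
    (hG a).star_eq, (hG b).star_eq, (hG c).star_eq, Matrix.trace_mul_comm]

theorem ofReal_dSymbol (hG : ∀ a, IsSelfAdjoint (G a)) (a b c : A) :
    (dSymbol G a b c : ℂ) = 2 * ((G a * G b * G c).trace + (G b * G a * G c).trace) := by
  rw [← star_trace_mul_mul hG a b c]
  simp only [dSymbol, add_mul, Matrix.trace_add]
  rw [← star_trace_mul_mul hG a b c]
  apply Complex.ext <;> simp

theorem ofReal_fSymbol (hG : ∀ a, IsSelfAdjoint (G a)) (a b c : A) :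
    (fSymbol G a b c : ℂ) =
      -2 * Complex.I * ((G a * G b * G c).trace - (G b * G a * G c).trace) := by
  rw [← star_trace_mul_mul hG a b c]
  simp only [fSymbol, sub_mul, Matrix.trace_sub]
  rw [← star_trace_mul_mul hG a b c]
  apply Complex.ext <;> simp

theorem expressible_trace_three [Fintype A] [DecidableEq A] (hG : ∀ a, IsSelfAdjoint (G a)) :
    ExpressibleByDeltaFD ℂ G 3 (fun a => (G (a 0) * G (a 1) * G (a 2)).trace) := by
  have h := (ExpressibleByDeltaFD.d (𝕜 := ℂ) (G := G)).smul (1 / 4) |>.add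
    ((ExpressibleByDeltaFD.f (𝕜 := ℂ) (G := G)).smul (Complex.I / 4))
  convert h using 2 with a
  have h1 := ofReal_dSymbol hG (a 0) (a 1) (a 2)
  have h2 := ofReal_fSymbol hG (a 0) (a 1) (a 2)
  simp only [Complex.coe_algebraMap] at *
  change _ = 1 / 4 * (dSymbol G (a 0) (a 1) (a 2) : ℂ) +
    Complex.I / 4 * (fSymbol G (a 0) (a 1) (a 2) : ℂ)
  rw [h1, h2]
  linear_combination ((G (a 0) * G (a 1) * G (a 2)).trace -
    (G (a 1) * G (a 0) * G (a 2)).trace) / 2 * Complex.I_mul_I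

theorem sum_mul_self_of_complete [Fintype A] {α β : ℂ}
    (hG : ∀ X : Matrix (Fin N) (Fin N) ℂ,
      α • ∑ e, (X * G e).trace • G e + (β * X.trace) • 1 = X) :
    α • ∑ e, G e * G e = ((N : ℂ) - β) • (1 : Matrix (Fin N) (Fin N) ℂ) := by
  ext i s
  have h := fun r => mul_apply_mul_apply_of_complete hG 1 1 i r r s
  have h' := Finset.sum_congr (rfl : (Finset.univ : Finset (Fin N)) = _) fun r _ => h r
  simp only [one_mul, Matrix.one_apply_eq, mul_one, Finset.sum_const, Finset.card_univ,
    Fintype.card_fin, Finset.sum_add_distrib, ← Finset.mul_sum, nsmul_eq_mul] at h'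
  rw [Finset.sum_comm] at h'
  simp only [← Matrix.mul_apply, mul_one] at h'
  simp only [Matrix.smul_apply, Matrix.sum_apply, smul_eq_mul, sub_mul]
  linear_combination -h'

end Symbols

namespace SuGenerators

variable {N : ℕ} (T : SuGenerators N) {c : ℝ}

theorem trace_extended_mul_extended (c : ℝ) (a b : Option (Fin (N ^ 2 - 1))) :
    (T.extended c a * T.extended c b).trace =
      if a = b then (a.elim ((c : ℂ) ^ 2 * N) fun _ => 1 / 2) else 0 := by
  cases a <;> cases b <;>
    simp [extended, T.traceless, T.normalized, pow_two, mul_assoc]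

theorem exists_eq_sum_extended (hN : 1 ≤ N) (hc : c ≠ 0) (X : Matrix (Fin N) (Fin N) ℂ) :
    ∃ x : Option (Fin (N ^ 2 - 1)) → ℂ, ∑ a, x a • T.extended c a = X := by
  have hli : LinearIndependent ℂ (T.extended c) := by
    rw [Fintype.linearIndependent_iff]
    intro g hg a
    have h := congrArg (fun Z => (Z * T.extended c a).trace) hg
    simp only [Finset.sum_mul, Matrix.trace_sum, Matrix.smul_mul, Matrix.trace_smul,
      T.trace_extended_mul_extended, smul_eq_mul, mul_ite, mul_zero, Finset.sum_ite_eq',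
      Finset.mem_univ, if_true, Matrix.zero_mul, Matrix.trace_zero, mul_eq_zero] at h
    refine h.resolve_right ?_
    cases a with
    | none => simp [hc]; omega
    | some a => simp
  have hcard : Fintype.card (Option (Fin (N ^ 2 - 1))) =
      Module.finrank ℂ (Matrix (Fin N) (Fin N) ℂ) := by
    have : 1 ≤ N ^ 2 := Nat.one_le_pow _ _ hN
    simp only [Fintype.card_option, Fintype.card_fin, Module.finrank_matrix, Module.finrank_self]
    rw [Nat.sub_add_cancel this]
    ring
  have hspan := hli.span_eq_top_of_card_eq_finrank' hcard
  exact (Submodule.mem_span_range_iff_exists_fun ℂ).1 (hspan ▸ Submodule.mem_top)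

theorem gen_complete (hN : 1 ≤ N) (X : Matrix (Fin N) (Fin N) ℂ) :
    (2 : ℂ) • ∑ e, (X * T.gen e).trace • T.gen e + ((1 / N : ℂ) * X.trace) • 1 = X := by
  obtain ⟨x, rfl⟩ := T.exists_eq_sum_extended hN one_ne_zero X
  have hN' : (N : ℂ) ≠ 0 := by exact_mod_cast (by omega : N ≠ 0)
  have h : ∀ a : Fin (N ^ 2 - 1), 2 * (x (some a) * 2⁻¹) = x (some a) := fun a => by ring
  simp [Fintype.sum_option, extended, add_mul, Finset.sum_mul, Matrix.trace_sum, T.traceless,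
    T.normalized, Finset.smul_sum, smul_smul, h]
  rw [add_comm]
  congr 2
  field_simp

theorem extended_complete (hN : 1 ≤ N) (c : ℝ) (X : Matrix (Fin N) (Fin N) ℂ) :
    (2 : ℂ) • ∑ e, (X * T.extended c e).trace • T.extended c e +
      ((1 / N - 2 * (c : ℂ) ^ 2) * X.trace) • 1 = X := by
  conv_rhs => rw [← T.gen_complete hN X]
  simp only [Fintype.sum_option, extended, Matrix.mul_smul, mul_one, Matrix.trace_smul,
    smul_eq_mul]
  module

theorem isSymbolComplete_gen (hN : 1 ≤ N) : IsSymbolComplete T.gen 2 (1 / N) where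
  complete := T.gen_complete hN
  trace_one := by simpa [T.traceless] using ExpressibleByDeltaFD.d.contract.smul (G := T.gen) (0 : ℂ)
  trace_two := by
    simpa [T.normalized] using ExpressibleByDeltaFD.delta.smul (G := T.gen) (1 / 2 : ℂ)
  trace_three := expressible_trace_three T.hermitian

theorem isSymbolComplete_extended (hN : 1 ≤ N) (hc : c ≠ 0) :
    IsSymbolComplete (T.extended c) 2 (1 / N - 2 * (c : ℂ) ^ 2) := by
  have hT := T.extended_isSelfAdjoint c
  have hone : ExpressibleByDeltaFD ℂ (T.extended c) 1 (fun a => (T.extended c (a 0)).trace) := by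
    set K : ℂ := N - (1 / N - 2 * (c : ℂ) ^ 2) with hK
    have hK0 : K ≠ 0 := by
      have hN1 : (1 : ℝ) ≤ N := by exact_mod_cast hN
      have h1 : (1 : ℝ) / N ≤ 1 := by
        rw [div_le_one (by linarith)]
        exact hN1
      have h2 : 0 < c ^ 2 := by positivity
      have h3 : (N : ℝ) - (1 / N - 2 * c ^ 2) ≠ 0 := by
        apply ne_of_gt
        linarith
      rw [hK, show (N : ℂ) - (1 / N - 2 * (c : ℂ) ^ 2) = ((N - (1 / N - 2 * c ^ 2) : ℝ) : ℂ) by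
        push_cast; rfl]
      exact Complex.ofReal_ne_zero.2 h3
    have h := (ExpressibleByDeltaFD.d (𝕜 := ℂ) (G := T.extended c)).contract.smul (1 / (2 * K))
    convert h using 2 with a
    have hd : ∀ e, ((dSymbol (T.extended c) (a 0) e e : ℝ) : ℂ) =
        4 * (T.extended c (a 0) * (T.extended c e * T.extended c e)).trace := by
      intro e
      rw [ofReal_dSymbol hT, Matrix.trace_mul_cycle (T.extended c e) (T.extended c (a 0)), mul_assoc,
        Matrix.trace_mul_comm (T.extended c e * T.extended c e)]
      ring
    have hsum := congrArg (fun Z => (T.extended c (a 0) * Z).trace)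
      (sum_mul_self_of_complete (T.extended_complete hN c))
    simp only [Matrix.mul_smul, Matrix.trace_smul, mul_one, smul_eq_mul] at hsum
    rw [Finset.mul_sum, Matrix.trace_sum] at hsum
    change _ = 1 / (2 * K) * ∑ e, ((dSymbol (T.extended c) (a 0) e e : ℝ) : ℂ)
    simp only [hd, ← Finset.mul_sum]
    field_simp
    linear_combination -2 * hsum
  refine ⟨T.extended_complete hN c, hone, ?_, expressible_trace_three hT⟩
  have h := ((ExpressibleByDeltaFD.d (𝕜 := ℂ) (G := T.extended c)).prod hone).contract.smul
    (1 / (4 * (c : ℂ) ^ 2 * N))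
  convert h using 2 with a
  have hN' : (N : ℂ) ≠ 0 := by exact_mod_cast (by omega : N ≠ 0)
  have hc' : (c : ℂ) ≠ 0 := by exact_mod_cast hc
  change _ = 1 / (4 * (c : ℂ) ^ 2 * N) *
    ∑ e, ((dSymbol (T.extended c) (a 0) (a 1) e : ℝ) : ℂ) * (T.extended c e).trace
  have h0 : T.extended c none = (c : ℂ) • 1 := rfl
  have h1 : ∀ e, (T.extended c (some e)).trace = 0 := T.traceless
  rw [Fintype.sum_option, ofReal_dSymbol hT]
  simp only [h0, h1, mul_zero, Finset.sum_const_zero, add_zero, Matrix.mul_smul, mul_one,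
    Matrix.trace_smul, Matrix.trace_one, Fintype.card_fin, smul_eq_mul,
    Matrix.trace_mul_comm (T.extended c (a 1)) (T.extended c (a 0))]
  field_simp
  ring

end SuGenerators

section Plug

variable {N n k : ℕ}

/-- The form obtained by inserting a fixed matrix `Z` in the slots outside the range of `e`. -/
noncomputable def MultilinearMap.plug
    (Φ : MultilinearMap ℂ (fun _ : Fin n => Matrix (Fin N) (Fin N) ℂ) ℂ)
    (e : Fin k ↪ Fin n) (Z : Matrix (Fin N) (Fin N) ℂ) :
    MultilinearMap ℂ (fun _ : Fin k => Matrix (Fin N) (Fin N) ℂ) ℂ :=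
  have h : ∀ (_ : DecidableEq (Fin k)) (X : Fin k → Matrix (Fin N) (Fin N) ℂ) (i : Fin k) (x),
      Function.extend e (Function.update X i x) (fun _ => Z) =
        Function.update (Function.extend e X fun _ => Z) (e i) x := by
    intro _ X i x
    funext j
    by_cases hj : ∃ l, e l = j
    · obtain ⟨l, rfl⟩ := hj
      simp [e.injective.extend_apply, Function.update_apply]
    · have : j ≠ e i := fun h => hj ⟨i, h.symm⟩
      simp [Function.extend_apply' _ _ _ hj, this]
  { toFun := fun X => Φ (Function.extend e X fun _ => Z)
    map_update_add' := fun X i x y => by simp [h]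
    map_update_smul' := fun X i r x => by simp [h] }

theorem MultilinearMap.plug_apply
    (Φ : MultilinearMap ℂ (fun _ : Fin n => Matrix (Fin N) (Fin N) ℂ) ℂ)
    (e : Fin k ↪ Fin n) (Z : Matrix (Fin N) (Fin N) ℂ) (X : Fin k → Matrix (Fin N) (Fin N) ℂ) :
    Φ.plug e Z X = Φ (Function.extend e X fun _ => Z) := rfl

theorem IsUnitaryInvariant.plug
    {Φ : MultilinearMap ℂ (fun _ : Fin n => Matrix (Fin N) (Fin N) ℂ) ℂ}
    (hΦ : IsUnitaryInvariant Φ) (e : Fin k ↪ Fin n) (z : ℂ) :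
    IsUnitaryInvariant (Φ.plug e (z • 1)) := by
  intro U hU X
  rw [MultilinearMap.plug_apply, MultilinearMap.plug_apply]
  refine Eq.trans ?_ (hΦ U hU _)
  congr 1
  funext j
  by_cases hj : ∃ l, e l = j
  · obtain ⟨l, rfl⟩ := hj
    simp [e.injective.extend_apply]
  · simp [Function.extend_apply' _ _ _ hj, Matrix.mem_unitaryGroup_iff.1 hU]

theorem SuGenerators.expressible_of_isUnitaryInvariant (hN : 1 ≤ N) (T : SuGenerators N) {c : ℝ}
    (hc : c ≠ 0) {Φ : MultilinearMap ℂ (fun _ : Fin n => Matrix (Fin N) (Fin N) ℂ) ℂ}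
    (hΦ : IsUnitaryInvariant Φ) :
    ExpressibleByDeltaFD ℂ (T.extended c) n (fun a => Φ (fun i => T.extended c (a i))) ∧
      ∀ (k : ℕ) (e : Fin k ↪ Fin n), ExpressibleByDeltaFD ℂ T.gen k
        (suComponents (fun a => Φ (fun i => T.extended c (a i))) e) := by
  refine ⟨(T.isSymbolComplete_extended hN hc).expressible_of_invariant hΦ, fun k e => ?_⟩
  have h := (T.isSymbolComplete_gen hN).expressible_of_invariant (hΦ.plug e c)
  convert h using 2 with b
  rw [MultilinearMap.plug_apply, suComponents]
  congr 1
  funext i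
  by_cases hi : ∃ l, e l = i
  · obtain ⟨l, rfl⟩ := hi
    simp [e.injective.extend_apply, extended]
  · simp [Function.extend_apply' _ _ _ hi, extended]

theorem IsAdInvariantGL.isUnitaryInvariant
    {Φ : MultilinearMap ℂ (fun _ : Fin n => Matrix (Fin N) (Fin N) ℂ) ℂ}
    (hΦ : IsAdInvariantGL Φ) : IsUnitaryInvariant Φ := fun U hU X =>
  hΦ (Unitary.toUnits ⟨U, hU⟩) X

end Plug

section Complexification

variable {N n : ℕ} (T : SuGenerators N) (c : ℝ)

/-- The squared norm of the member `a` of the extended basis for the trace form. -/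
noncomputable def SuGenerators.weight (_ : SuGenerators N) (c : ℝ)
    (a : Option (Fin (N ^ 2 - 1))) : ℝ :=
  a.elim (c ^ 2 * N) fun _ => 1 / 2

/-- The coordinates of a matrix with respect to the basis `i G^a`. -/
noncomputable def SuGenerators.coord (a : Option (Fin (N ^ 2 - 1))) :
    Matrix (Fin N) (Fin N) ℂ →ₗ[ℂ] ℂ :=
  (-Complex.I / T.weight c a) •
    (Matrix.traceLinearMap (Fin N) ℂ ℂ ∘ₗ LinearMap.mulRight ℂ (T.extended c a))

theorem SuGenerators.coord_apply (a : Option (Fin (N ^ 2 - 1))) (X : Matrix (Fin N) (Fin N) ℂ) :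
    T.coord c a X = -Complex.I / T.weight c a * (X * T.extended c a).trace := rfl

variable {c}

theorem SuGenerators.sum_coord_smul (hN : 1 ≤ N) (hc : c ≠ 0) (X : Matrix (Fin N) (Fin N) ℂ) :
    ∑ a, T.coord c a X • (T.extendedU c a : Matrix (Fin N) (Fin N) ℂ) = X := by
  obtain ⟨x, rfl⟩ := T.exists_eq_sum_extended hN hc X
  refine Finset.sum_congr rfl fun a _ => ?_
  have hw : (T.weight c a : ℂ) ≠ 0 := by
    cases a with
    | none => simp [weight, hc]; omega
    | some a => simp [weight]
  have hw' : ∀ b, (if b = a then (b.elim ((c : ℂ) ^ 2 * N) fun _ => 1 / 2) else 0 : ℂ) =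
      if b = a then (T.weight c a : ℂ) else 0 := by
    intro b
    split_ifs with h
    · subst h
      cases b <;> simp [weight]
    · rfl
  rw [coord_apply]
  simp only [Finset.sum_mul, Matrix.trace_sum, Matrix.smul_mul, Matrix.trace_smul,
    T.trace_extended_mul_extended, hw', smul_eq_mul, mul_ite, mul_zero, Finset.sum_ite_eq',
    Finset.mem_univ, if_true, extendedU, smul_smul]
  congr 1
  field_simp
  linear_combination -(x a) * Complex.I_sq

theorem SuGenerators.coord_im (a : Option (Fin (N ^ 2 - 1))) (Y : UnitaryLie N) :
    (T.coord c a Y).im = 0 := by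
  have h : star ((Y : Matrix (Fin N) (Fin N) ℂ) * T.extended c a).trace =
      -((Y : Matrix (Fin N) (Fin N) ℂ) * T.extended c a).trace := by
    rw [← Matrix.trace_conjTranspose, ← Matrix.star_eq_conjTranspose, star_mul,
      (T.extended_isSelfAdjoint c a).star_eq, skewAdjoint.mem_iff.1 Y.2, Matrix.trace_mul_comm,
      neg_mul, Matrix.trace_neg]
  rw [← Complex.conj_eq_iff_im, coord_apply]
  rw [← starRingEnd_apply] at h
  simp only [map_mul, map_div₀, map_neg, Complex.conj_I, Complex.conj_ofReal, h]
  ring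

/-- The complex multilinear extension to `gl(N, ℂ)` of a real multilinear form on `u(N)`. -/
noncomputable def SuGenerators.complexify (c : ℝ)
    (Φ : MultilinearMap ℝ (fun _ : Fin n => UnitaryLie N) ℝ) :
    MultilinearMap ℂ (fun _ : Fin n => Matrix (Fin N) (Fin N) ℂ) ℂ :=
  ∑ a : Fin n → Option (Fin (N ^ 2 - 1)), (Φ (fun k => T.extendedU c (a k)) : ℂ) •
    (MultilinearMap.mkPiAlgebra ℂ (Fin n) ℂ).compLinearMap fun k => T.coord c (a k)

theorem SuGenerators.complexify_apply_coe (hN : 1 ≤ N) (hc : c ≠ 0)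
    (Φ : MultilinearMap ℝ (fun _ : Fin n => UnitaryLie N) ℝ) (Y : Fin n → UnitaryLie N) :
    T.complexify c Φ (fun k => (Y k : Matrix (Fin N) (Fin N) ℂ)) = Φ Y := by
  have hre : ∀ a k, ((T.coord c a (Y k)).re : ℂ) = T.coord c a (Y k) := fun a k =>
    Complex.ext rfl (T.coord_im a (Y k)).symm
  have hY : Y = fun k => ∑ a, (T.coord c a (Y k)).re • T.extendedU c a := by
    funext k
    refine Subtype.ext ?_
    conv_lhs => rw [← T.sum_coord_smul hN hc (Y k)]
    rw [AddSubgroup.val_finsetSum]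
    refine Finset.sum_congr rfl fun a _ => ?_
    rw [← hre a k]
    rfl
  conv_rhs => rw [hY]
  rw [Φ.map_sum]
  simp only [Φ.map_smul_univ, complexify, sum_apply, smul_apply,
    MultilinearMap.compLinearMap_apply, MultilinearMap.mkPiAlgebra_apply, smul_eq_mul]
  push_cast
  refine Finset.sum_congr rfl fun a _ => ?_
  rw [mul_comm]
  simp only [hre]

theorem SuGenerators.multilinear_ext (T : SuGenerators N) (hN : 1 ≤ N) (hc : c ≠ 0)
    {Φ Ψ : MultilinearMap ℂ (fun _ : Fin n => Matrix (Fin N) (Fin N) ℂ) ℂ}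
    (h : ∀ Y : Fin n → UnitaryLie N, Φ (fun k => Y k) = Ψ (fun k => Y k)) : Φ = Ψ := by
  refine MultilinearMap.ext fun X => ?_
  have hX : X = fun k => ∑ a, T.coord c a (X k) • (T.extendedU c a : Matrix (Fin N) (Fin N) ℂ) :=
    funext fun k => (T.sum_coord_smul hN hc (X k)).symm
  rw [hX, Φ.map_sum, Ψ.map_sum]
  refine Finset.sum_congr rfl fun a _ => ?_
  rw [Φ.map_smul_univ, Ψ.map_smul_univ, h fun k => T.extendedU c (a k)]

theorem IsAdInvariantU.complexify (hN : 1 ≤ N) (hc : c ≠ 0)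
    {Φ : MultilinearMap ℝ (fun _ : Fin n => UnitaryLie N) ℝ} (hΦ : IsAdInvariantU Φ) :
    IsUnitaryInvariant (T.complexify c Φ) := by
  intro U hU X
  have h : (T.complexify c Φ).compLinearMap (fun _ : Fin n =>
      LinearMap.mulRight ℂ (star U) ∘ₗ LinearMap.mulLeft ℂ U) = T.complexify c Φ := by
    refine T.multilinear_ext hN hc fun Y => ?_
    rw [T.complexify_apply_coe hN hc, ← hΦ ⟨U, hU⟩, ← T.complexify_apply_coe hN hc]
    rfl
  exact congrArg (fun Ψ : MultilinearMap ℂ (fun _ : Fin n => Matrix (Fin N) (Fin N) ℂ) ℂ => Ψ X) h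

theorem SuGenerators.ofReal_apply_extendedU (hN : 1 ≤ N) (hc : c ≠ 0)
    (Φ : MultilinearMap ℝ (fun _ : Fin n => UnitaryLie N) ℝ)
    (a : Fin n → Option (Fin (N ^ 2 - 1))) :
    Φ (fun i => T.extendedU c (a i)) =
      (Complex.I ^ n * T.complexify c Φ (fun i => T.extended c (a i))).re := by
  have h := T.complexify_apply_coe hN hc Φ fun i => T.extendedU c (a i)
  have h' := (T.complexify c Φ).map_smul_univ (fun _ => Complex.I) fun i => T.extended c (a i)
  simp only [Finset.prod_const, Finset.card_univ, Fintype.card_fin, smul_eq_mul] at h'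
  rw [← h', ← Complex.ofReal_re (Φ _), ← h]
  rfl

end Complexification

theorem mainTheorem5 (N : ℕ) (hN : 1 ≤ N) (T : SuGenerators N) (c : ℝ) (hc : c ≠ 0) (n : ℕ) :
    (∀ Φ : MultilinearMap ℂ (fun _ : Fin n => Matrix (Fin N) (Fin N) ℂ) ℂ, IsAdInvariantGL Φ →
      ExpressibleByDeltaFD ℂ (T.extended c) n (fun a => Φ (fun i => T.extended c (a i))) ∧
      ∀ (k : ℕ) (e : Fin k ↪ Fin n), ExpressibleByDeltaFD ℂ T.gen k
        (suComponents (fun a => Φ (fun i => T.extended c (a i))) e)) ∧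
    (∀ Φ : MultilinearMap ℝ (fun _ : Fin n => UnitaryLie N) ℝ, IsAdInvariantU Φ →
      ExpressibleByDeltaFD ℝ (T.extended c) n (fun a => Φ (fun i => T.extendedU c (a i))) ∧
      ∀ (k : ℕ) (e : Fin k ↪ Fin n), ExpressibleByDeltaFD ℝ T.gen k
        (suComponents (fun a => Φ (fun i => T.extendedU c (a i))) e)) := by
  refine ⟨fun Φ hΦ => T.expressible_of_isUnitaryInvariant hN hc hΦ.isUnitaryInvariant,
    fun Φ hΦ => ?_⟩
  obtain ⟨h1, h2⟩ := T.expressible_of_isUnitaryInvariant hN hc (hΦ.complexify T hN hc)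
  simp only [T.ofReal_apply_extendedU hN hc]
  exact ⟨(h1.smul (Complex.I ^ n)).re_im.1, fun k e => ((h2 k e).smul (Complex.I ^ n)).re_im.1⟩
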